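/- For $0<\alpha\le 2$, let $S(\alpha,1)$ denote the symmetric $\alpha$-stable distribution with unit scale, i.e. the law of a real random variable $Z$ with $E\,e^{\sqrt{-1}\,Zt}=e^{-|t|^{\alpha}}$ for all $t\in\mathbb{R}$. Let $0<\alpha\le 2$, $\alpha\ne 1$, let $M\ge 1$, let $x\in\mathbb{R}^{N}$ be a fixed nonzero vector, and let $\epsilon>0$. Let $\mathbf{S}=(s_{ij})\in\mathbb{R}^{N\times M}$ be a random matrix whose entries are i.i.d. with law $S(\alpha,1)$, and let $y_j=\sum_{k=1}^{N}x_k s_{kj}$, $1\le j\le M$, be the measurements. For each $i$ the absolute minimum estimator of $x_i$ is $$\hat{x}_{i,\min}=\frac{y_t}{s_{it}},\qquad t=\operatorname*{argmin}_{1\le j\le M}\left|\frac{y_j}{s_{ij}}\right|.$$ Theorem (Analysis of False Positives). Let $\theta>0$ be given by $\theta^{\alpha}=\sum_{i=1}^{N}|x_i|^{\alpha}$ and put $\psi=(\epsilon/\theta)^{\alpha/(1-\alpha)}$. If $\psi\le 1/3$, then for every $i\in\{1,\dots,N\}$ $$\Pr\bigl(|\hat{x}_{i,\min}|>\epsilon,\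 x_i=0\bigr)\le\frac{1}{(1+\psi)^{M}}.$$ -/

import Mathlib

open MeasureTheory ProbabilityTheory
open scoped Matrix

/-- The real random variable `Z` on `(Ω, μ)` has the symmetric `α`-stable distribution with unit
scale, `Z ∼ S(α, 1)`: its characteristic function is `t ↦ exp (-|t| ^ α)`. -/
structure IsStandardStable {Ω : Type*} [MeasurableSpace Ω] (α : ℝ) (Z : Ω → ℝ)
    (μ : Measure Ω) : Prop where
  aemeasurable : AEMeasurable Z μ
  charFun_eq : ∀ t : ℝ, charFun (μ.map Z) t = Complex.exp (-((|t| ^ α : ℝ) : ℂ))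

/-- `S` is a random design matrix whose entries are i.i.d. samples from `S(α, 1)`. -/
structure IsStableDesign {Ω : Type*} [MeasurableSpace Ω] {N M : ℕ} (α : ℝ)
    (S : Ω → Matrix (Fin N) (Fin M) ℝ) (μ : Measure Ω) : Prop where
  stable : ∀ i j, IsStandardStable α (fun ω => S ω i j) μ
  indep : iIndepFun (fun (p : Fin N × Fin M) (ω : Ω) => S ω p.1 p.2) μ

/-- The ratio statistics `z_{i,j} = y_j / s_{ij}`. -/
noncomputable def ratioStat {N M : ℕ} (S : Matrix (Fin N) (Fin M) ℝ) (y : Fin M → ℝ)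
    (i : Fin N) (j : Fin M) : ℝ :=
  y j / S i j

/-- An index `t` minimizing `|z t|`. -/
noncomputable def argminAbs {M : ℕ} [NeZero M] (z : Fin M → ℝ) : Fin M :=
  (Finite.exists_min (fun j => |z j|)).choose

theorem abs_argminAbs_le {M : ℕ} [NeZero M] (z : Fin M → ℝ) (j : Fin M) :
    |z (argminAbs z)| ≤ |z j| :=
  (Finite.exists_min (fun j => |z j|)).choose_spec j

/-- The absolute minimum estimator of the coordinate `i` of the signal, computed from the design
matrix `S` and the measurements `y`. -/
noncomputable def absMinEstimator {N M : ℕ} [NeZero M] (S : Matrix (Fin N) (Fin M) ℝ)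
    (y : Fin M → ℝ) (i : Fin N) : ℝ :=
  ratioStat S y i (argminAbs (ratioStat S y i))

/-- The scale `θ` of the signal, given by `θ ^ α = ∑ i, |x i| ^ α`. -/
noncomputable def signalScale {N : ℕ} (α : ℝ) (x : Fin N → ℝ) : ℝ :=
  (∑ i, |x i| ^ α) ^ (1 / α)

/-- The quantity `ψ = (ε / θ) ^ (α / (1 - α))`. -/
noncomputable def psi {N : ℕ} (α ε : ℝ) (x : Fin N → ℝ) : ℝ :=
  (ε / signalScale α x) ^ (α / (1 - α))

/-! If `x i = 0`, then `y_j / θ` is standard stable and independent of `s_ij`. The columns are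
independent, so it suffices to bound `P(c|S| < |S'|)` by `1 / (1 + c ^ α)` for independent standard
stable `S`, `S'` and `c ≤ 1` (`prod_setOf_mul_abs_lt_abs_le`).

Let `E`, `E'` be standard exponential, `G` Gaussian and `Θ`, `Θ'` uniform angles, all independent.
Fourier duality between `S` and `G` gives `√(2E) / |S| ~ E ^ (1/α) / |G|`, and polar coordinates
give `|G| ~ √(2E) |cos Θ|`. In characteristic functions of logarithms the `√(2E)` factors are
nonzero Gamma values and cancel, so `log |S / S'|` is distributed as `log (E / E') / α + log |cos Θ|
- log |cos Θ'|`: a logistic variable plus independent symmetric noise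
(`map_log_conv_map_neg_log_of_charFun_eq`). At levels `v ≤ 0` such noise can only lower the logistic
tail (`logisticLaw_conv_Ioi_le`). -/

/-! ### Logarithms of exponential variables. -/

instance isProbabilityMeasure_expMeasure_one : IsProbabilityMeasure (expMeasure 1) :=
  isProbabilityMeasure_expMeasure one_pos

theorem expMeasure_one_Ioi {x : ℝ} (hx : 0 ≤ x) :
    expMeasure 1 (Set.Ioi x) = ENNReal.ofReal (Real.exp (-x)) := by
  rw [← Set.compl_Iic, prob_compl_eq_one_sub measurableSet_Iic, ← ofReal_cdf,
    cdf_expMeasure_eq one_pos, if_pos hx, ← ENNReal.ofReal_one,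
    ← ENNReal.ofReal_sub _ (by simp [hx])]
  simp

theorem integral_expMeasure_one {E : Type*} [NormedAddCommGroup E] [NormedSpace ℝ E] (f : ℝ → E) :
    ∫ x, f x ∂(expMeasure 1) = ∫ x in Set.Ioi 0, Real.exp (-x) • f x := by
  rw [expMeasure, gammaMeasure, integral_withDensity_eq_integral_toReal_smul
    (by exact (measurable_gammaPDFReal 1 1).ennreal_ofReal) (by simp [gammaPDF]),
    ← integral_Ici_eq_integral_Ioi, ← integral_indicator measurableSet_Ici]
  congr 1 with x
  by_cases hx : 0 ≤ x
  · rw [Set.indicator_of_mem (by exact hx)]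
    congr 1
    have := exponentialPDF_of_nonneg (r := 1) hx
    rw [exponentialPDF, exponentialPDFReal] at this
    rw [gammaPDF, this, ENNReal.toReal_ofReal (by positivity)]
    simp
  · rw [Set.indicator_of_notMem (by exact hx), gammaPDF_of_neg (not_le.1 hx)]
    simp

theorem charFun_map_log_expMeasure_one (t : ℝ) :
    charFun ((expMeasure 1).map Real.log) t = Complex.Gamma (1 + t * Complex.I) := by
  rw [charFun_apply_real, integral_map (by fun_prop) (by fun_prop), integral_expMeasure_one,
    Complex.Gamma_eq_integral (by simp), Complex.GammaIntegral]
  refine setIntegral_congr_fun measurableSet_Ioi fun x (hx : 0 < x) => ?_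
  simp only [Complex.real_smul]
  rw [Complex.cpow_def_of_ne_zero (by exact_mod_cast hx.ne'), ← Complex.ofReal_log hx.le]
  ring_nf

/-- Nonvanishing is what later permits dividing out an exponential factor. -/
theorem charFun_map_log_expMeasure_one_ne_zero (t : ℝ) :
    charFun ((expMeasure 1).map Real.log) t ≠ 0 := by
  rw [charFun_map_log_expMeasure_one]
  exact Complex.Gamma_ne_zero_of_re_pos (by simp)

theorem conv_Ioi (μ ν : Measure ℝ) [SFinite μ] [SFinite ν] (v : ℝ) :
    (μ ∗ ν) (Set.Ioi v) = ∫⁻ y, μ (Set.Ioi (v - y)) ∂ν := by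
  rw [Measure.conv, Measure.map_apply (by fun_prop) measurableSet_Ioi,
    Measure.prod_apply_symm (measurableSet_Ioi.preimage (by fun_prop))]
  congr 1 with y
  congr 1 with x
  simp [sub_lt_iff_lt_add]

theorem map_log_expMeasure_one_Ioi (w : ℝ) :
    (expMeasure 1).map Real.log (Set.Ioi w) = ENNReal.ofReal (Real.exp (-Real.exp w)) := by
  rw [Measure.map_apply (by fun_prop) measurableSet_Ioi,
    ← expMeasure_one_Ioi (Real.exp_pos w).le]
  refine measure_congr ?_
  have h0 : ∀ᵐ x ∂(expMeasure 1), 0 < x := by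
    rw [ae_iff, show {x : ℝ | ¬ 0 < x} = (Set.Ioi 0)ᶜ by ext; simp,
      prob_compl_eq_zero_iff measurableSet_Ioi, expMeasure_one_Ioi le_rfl]
    simp
  filter_upwards [h0] with x hx
  exact propext (Real.lt_log_iff_exp_lt hx)

/-- Conditioning on `x`, the event is `E > e^v |x|^p`: an independent exponential turns a Laplace
transform into a tail. An atom at `0` is excluded because `Real.log 0 = 0`. -/
theorem map_log_expMeasure_one_conv_Ioi (ν : Measure ℝ) [SFinite ν] (hν : ν {0} = 0) (p v : ℝ) :
    ((expMeasure 1).map Real.log ∗ ν.map (fun x => -p * Real.log x)) (Set.Ioi v)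
      = ∫⁻ x, ENNReal.ofReal (Real.exp (-(Real.exp v * |x| ^ p))) ∂ν := by
  have : IsProbabilityMeasure ((expMeasure 1).map Real.log) :=
    Measure.isProbabilityMeasure_map (by fun_prop)
  rw [conv_Ioi]
  simp_rw [map_log_expMeasure_one_Ioi]
  rw [lintegral_map (by fun_prop) (by fun_prop)]
  refine lintegral_congr_ae ?_
  have h0 : ∀ᵐ x ∂ν, x ≠ 0 := by simpa [ae_iff] using hν
  filter_upwards [h0] with x hx
  rw [Real.rpow_def_of_pos (abs_pos.2 hx), ← Real.exp_add, Real.log_abs]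
  ring_nf

theorem lintegral_exp_neg_mul_expMeasure_one {k : ℝ} (hk : 0 ≤ k) :
    ∫⁻ x, ENNReal.ofReal (Real.exp (-(k * |x|))) ∂(expMeasure 1) = ENNReal.ofReal (1 / (1 + k)) := by
  rw [← ofReal_integral_eq_lintegral_ofReal, integral_expMeasure_one]
  · congr 1
    have h := integral_exp_neg_mul_rpow (p := 1) (b := 1 + k) one_pos (by positivity)
    rw [setIntegral_congr_fun (g := fun x => Real.exp (-(1 + k) * x ^ (1:ℝ))) measurableSet_Ioi, h]
    · norm_num [Real.rpow_neg_one]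
    · intro x (hx : 0 < x)
      simp only [smul_eq_mul, ← Real.exp_add, abs_of_pos hx, Real.rpow_one]
      ring_nf
  · refine (integrable_const (1 : ℝ)).mono (by fun_prop) (.of_forall fun x => ?_)
    simp [abs_of_pos (Real.exp_pos _)]
    positivity
  · exact .of_forall fun x => (Real.exp_pos _).le

/-! ### Logistic laws and symmetric noise. -/

/-- The law of `log (E / E') / α` for independent standard exponential variables `E`, `E'`. -/
noncomputable def logisticLaw (α : ℝ) : Measure ℝ :=
  ((expMeasure 1).map Real.log ∗ (expMeasure 1).map (fun x => -1 * Real.log x)).map (α⁻¹ * ·)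

instance isProbabilityMeasure_logisticLaw (α : ℝ) : IsProbabilityMeasure (logisticLaw α) := by
  have h1 : IsProbabilityMeasure ((expMeasure 1).map Real.log) :=
    Measure.isProbabilityMeasure_map (by fun_prop)
  have h2 : IsProbabilityMeasure ((expMeasure 1).map (fun x => -1 * Real.log x)) :=
    Measure.isProbabilityMeasure_map (by fun_prop)
  exact Measure.isProbabilityMeasure_map (by fun_prop)

theorem logisticLaw_Ioi {α : ℝ} (hα : 0 < α) (v : ℝ) :
    logisticLaw α (Set.Ioi v) = ENNReal.ofReal (1 / (1 + Real.exp (α * v))) := by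
  have h0 : expMeasure 1 {0} = 0 := by
    rw [expMeasure, gammaMeasure]
    exact (withDensity_absolutelyContinuous _ _) (by simp)
  have h := map_log_expMeasure_one_conv_Ioi _ h0 1 (α * v)
  simp only [Real.rpow_one] at h
  rw [← lintegral_exp_neg_mul_expMeasure_one (Real.exp_pos _).le, ← h, logisticLaw,
    Measure.map_apply (by fun_prop) measurableSet_Ioi]
  congr 1 with y
  simp only [Set.mem_preimage, Set.mem_Ioi]
  rw [lt_inv_mul_iff₀ hα]

theorem charFun_logisticLaw (α t : ℝ) :
    charFun (logisticLaw α) t = charFun ((expMeasure 1).map Real.log) (α⁻¹ * t)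
      * charFun ((expMeasure 1).map Real.log) (-(α⁻¹ * t)) := by
  have h1 : IsProbabilityMeasure ((expMeasure 1).map Real.log) :=
    Measure.isProbabilityMeasure_map (by fun_prop)
  have h2 : IsProbabilityMeasure ((expMeasure 1).map (fun x => -1 * Real.log x)) :=
    Measure.isProbabilityMeasure_map (by fun_prop)
  rw [logisticLaw, charFun_map_mul, charFun_conv, charFun_map_mul_comp (by fun_prop), neg_one_mul]

/-- The pointwise inequality behind `logisticLaw_conv_Ioi_le`. -/
theorem logistic_add_logistic_le {a r : ℝ} (ha : 0 < a) (ha₁ : a ≤ 1) (hr : 0 < r) :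
    1 / (1 + a * r) + 1 / (1 + a * r⁻¹) ≤ 2 * (1 / (1 + a)) := by
  have : 1 / (1 + a * r⁻¹) = r / (r + a) := by field_simp
  rw [this, div_add_div _ _ (by positivity) (by positivity), ← mul_div_assoc,
    div_le_div_iff₀ (by positivity) (by positivity)]
  -- With denominators cleared, the gap is exactly `a (1 - a) (1 - r) ^ 2`.
  nlinarith [mul_nonneg (mul_nonneg ha.le (sub_nonneg.2 ha₁)) (sq_nonneg (1 - r))]

/-- Symmetry of `m` allows averaging the tails at `v - y` and `v + y`; for `v ≤ 0` this average is
at most the tail at `v`. -/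
theorem logisticLaw_conv_Ioi_le {α : ℝ} (hα : 0 < α) (m : Measure ℝ) [IsProbabilityMeasure m]
    (hm : m.map Neg.neg = m) {v : ℝ} (hv : v ≤ 0) :
    (logisticLaw α ∗ m) (Set.Ioi v) ≤ ENNReal.ofReal (1 / (1 + Real.exp (α * v))) := by
  have key : ∫⁻ y, ENNReal.ofReal (1 / (1 + Real.exp (α * (v - y)))) ∂m
      = ∫⁻ y, ENNReal.ofReal (1 / (1 + Real.exp (α * (v + y)))) ∂m := by
    conv_lhs => rw [← hm]
    rw [lintegral_map (by fun_prop) (by fun_prop)]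
    simp
  rw [conv_Ioi]
  simp_rw [logisticLaw_Ioi hα]
  have h2 : 2 * ∫⁻ y, ENNReal.ofReal (1 / (1 + Real.exp (α * (v - y)))) ∂m
      ≤ 2 * ENNReal.ofReal (1 / (1 + Real.exp (α * v))) := by
    rw [two_mul]
    nth_rewrite 2 [key]
    rw [← lintegral_add_left (by fun_prop)]
    calc _ ≤ ∫⁻ _, 2 * ENNReal.ofReal (1 / (1 + Real.exp (α * v))) ∂m := by
          refine lintegral_mono fun y => ?_
          rw [← ENNReal.ofReal_add (by positivity) (by positivity)]
          rw [show (2 : ENNReal) = ENNReal.ofReal 2 by simp, ← ENNReal.ofReal_mul (by norm_num)]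
          refine ENNReal.ofReal_le_ofReal ?_
          have := logistic_add_logistic_le (a := Real.exp (α * v)) (r := Real.exp (-(α * y)))
            (Real.exp_pos _) (Real.exp_le_one_iff.2 (mul_nonpos_of_nonneg_of_nonpos hα.le hv))
            (Real.exp_pos _)
          rw [← Real.exp_neg, ← Real.exp_add, ← Real.exp_add] at this
          convert this using 4 <;> ring_nf
      _ = _ := by simp
  exact (ENNReal.mul_le_mul_iff_right (by simp) (by simp)).1 h2

/-! ### Polar decomposition of a Gaussian. -/

/-- The law of `log |cos Θ|` for `Θ` uniform on the circle. -/
noncomputable def logCosLaw : Measure ℝ :=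
  ((ENNReal.ofReal (2 * Real.pi))⁻¹ • volume.restrict (Set.Ioo (-Real.pi) Real.pi)).map
    (fun θ => Real.log (Real.cos θ))

instance isProbabilityMeasure_logCosLaw : IsProbabilityMeasure logCosLaw := by
  have : IsProbabilityMeasure ((ENNReal.ofReal (2 * Real.pi))⁻¹ •
      volume.restrict (Set.Ioo (-Real.pi) Real.pi)) := by
    constructor
    simp only [Measure.smul_apply, Measure.restrict_apply_univ, Real.volume_Ioo, smul_eq_mul]
    rw [show Real.pi - -Real.pi = 2 * Real.pi by ring]
    exact ENNReal.inv_mul_cancel (by simp [Real.pi_pos]) ENNReal.ofReal_ne_top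
  exact Measure.isProbabilityMeasure_map (by fun_prop)

theorem charFun_logCosLaw (t : ℝ) :
    charFun logCosLaw t = (2 * Real.pi : ℝ)⁻¹ •
      ∫ θ in Set.Ioo (-Real.pi) Real.pi, Complex.exp (t * Real.log (Real.cos θ) * Complex.I) := by
  rw [charFun_apply_real, logCosLaw, integral_map (by fun_prop) (by fun_prop),
    integral_smul_measure, ENNReal.toReal_inv, ENNReal.toReal_ofReal (by positivity)]

/-- The radial factor: substituting `x = r ^ 2 / 2` makes the radius `√(2E)`. -/
theorem integral_mul_exp_neg_sq_mul_exp_log (t : ℝ) :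
    ∫ r in Set.Ioi (0 : ℝ), r • (Real.exp (-(r ^ 2 / 2)) • Complex.exp (t * Real.log r * Complex.I))
      = Complex.exp (t / 2 * Real.log 2 * Complex.I)
        * charFun ((expMeasure 1).map Real.log) (t / 2) := by
  rw [charFun_apply_real, integral_map (by fun_prop) (by fun_prop), integral_expMeasure_one,
    ← integral_const_mul]
  let f : ℝ → ℂ := fun x => Real.exp (-(x / 2)) • Complex.exp (t / 2 * Real.log x * Complex.I)
  have h := integral_comp_mul_left_Ioi f 0 two_pos
  rw [mul_zero, ← integral_comp_rpow_Ioi f (p := 2) two_ne_zero, ← integral_smul] at h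
  refine (Eq.trans ?_ h.symm).trans ?_
  · refine setIntegral_congr_fun measurableSet_Ioi fun r (hr : 0 < r) => ?_
    simp only [smul_smul, f]
    rw [Real.log_rpow hr]
    norm_num
    ring_nf
  · refine setIntegral_congr_fun measurableSet_Ioi fun x (hx : 0 < x) => ?_
    simp only [f]
    rw [Real.log_mul two_ne_zero hx.ne', mul_smul_comm, ← Complex.exp_add]
    push_cast
    ring_nf

theorem charFun_map_log_gaussianReal (t : ℝ) :
    charFun ((gaussianReal 0 1).map Real.log) t = Complex.exp (t / 2 * Real.log 2 * Complex.I)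
      * charFun ((expMeasure 1).map Real.log) (t / 2) * charFun logCosLaw t := by
  rw [← integral_mul_exp_neg_sq_mul_exp_log, charFun_logCosLaw, charFun_apply_real,
    integral_map (by fun_prop) (by fun_prop), integral_gaussianReal_eq_integral_smul one_ne_zero]
  -- A second Gaussian coordinate of total mass one makes the integral planar, ready for polar
  -- coordinates.
  have h1 : ∫ y, (gaussianPDFReal 0 1 y : ℂ) = 1 := by
    rw [integral_complex_ofReal, integral_gaussianPDFReal_eq_one 0 one_ne_zero]; simp
  rw [← mul_one (∫ x, _ • _), ← h1, ← integral_prod_mul, ← Measure.volume_eq_prod,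
    ← integral_comp_polarCoord_symm, ← integral_smul, ← setIntegral_prod_mul, polarCoord_target,
    Measure.volume_eq_prod]
  have hcos : ∀ᵐ p ∂((volume : Measure ℝ).prod (volume : Measure ℝ)), Real.cos p.2 ≠ 0 := by
    have : ∀ᵐ θ : ℝ, Real.cos θ ≠ 0 := by
      rw [ae_iff]
      refine Set.Countable.measure_zero ?_ _
      simp only [ne_eq, not_not, Real.cos_eq_zero_iff]
      refine (Set.countable_range (fun k : ℤ => (2 * (k : ℝ) + 1) * Real.pi / 2)).mono ?_
      rintro x ⟨k, hk⟩
      exact ⟨k, hk.symm⟩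
    exact Measure.quasiMeasurePreserving_snd.ae this
  refine setIntegral_congr_ae (measurableSet_Ioi.prod measurableSet_Ioo) ?_
  filter_upwards [hcos] with p hp hpt
  have hr : 0 < p.1 := hpt.1
  simp only [polarCoord_symm_apply]
  rw [Real.log_mul hr.ne' hp]
  simp only [gaussianPDFReal_def, Complex.real_smul, NNReal.coe_one, mul_one]
  have : (√(2 * Real.pi))⁻¹ * (√(2 * Real.pi))⁻¹ = (2 * Real.pi)⁻¹ := by
    rw [← mul_inv, Real.mul_self_sqrt (by positivity)]
  have e : Real.exp (-(p.1 * Real.cos p.2 - 0) ^ 2 / 2)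
      * Real.exp (-(p.1 * Real.sin p.2 - 0) ^ 2 / 2) = Real.exp (-(p.1 ^ 2 / 2)) := by
    rw [← Real.exp_add]
    congr 1
    linear_combination (-p.1 ^ 2 / 2) * Real.cos_sq_add_sin_sq p.2
  rw [← this, ← e]
  push_cast
  rw [mul_add, add_mul, Complex.exp_add]
  ring

/-! ### Ratios of independent stable variables. -/

theorem integrable_exp_neg_mul_abs_rpow (ν : Measure ℝ) [IsFiniteMeasure ν] {c : ℝ} (hc : 0 ≤ c)
    (p : ℝ) : Integrable (fun x => Real.exp (-(c * |x| ^ p))) ν := by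
  have hm : Measurable fun x : ℝ => Real.exp (-(c * |x| ^ p)) :=
    (((measurable_norm (α := ℝ)).pow_const p).const_mul c).neg.exp
  refine (integrable_const (1 : ℝ)).mono hm.aestronglyMeasurable (.of_forall fun s => ?_)
  rw [Real.norm_eq_abs, Real.abs_exp, norm_one, Real.exp_le_one_iff]
  have : 0 ≤ c * |s| ^ p := by positivity
  linarith

section Stable

variable {α : ℝ} {σ : Measure ℝ} [IsProbabilityMeasure σ]

/-- Fubini for `exp (i c s g)`: one order produces the Gaussian characteristic function, the other
the stable one. -/
theorem integral_exp_neg_sq_eq_gaussianReal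
    (hσ : ∀ t : ℝ, charFun σ t = Complex.exp (-((|t| ^ α : ℝ) : ℂ))) {c : ℝ} (hc : 0 ≤ c) :
    ∫ s, Real.exp (-(c ^ 2 / 2 * |s| ^ (2 : ℝ))) ∂σ
      = ∫ g, Real.exp (-(c ^ α * |g| ^ α)) ∂(gaussianReal 0 1) := by
  have h1 : ∫ s, charFun (gaussianReal 0 1) (c * s) ∂σ
      = ∫ g, charFun σ (c * g) ∂(gaussianReal 0 1) := by
    simp_rw [charFun_apply_real]
    rw [integral_integral_swap]
    · congr 1 with s
      congr 1 with g
      push_cast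
      ring_nf
    · refine (integrable_const (1 : ℝ)).mono (by fun_prop) (.of_forall fun p => ?_)
      have := Complex.norm_exp_ofReal_mul_I (c * p.1 * p.2)
      push_cast at this
      simp [Function.uncurry, this]
  simp_rw [hσ, charFun_gaussianReal] at h1
  apply Complex.ofReal_injective
  rw [← integral_complex_ofReal, ← integral_complex_ofReal]
  refine Eq.trans (integral_congr_ae (.of_forall fun s => ?_))
    (h1.trans (integral_congr_ae (.of_forall fun g => ?_)))
  · simp only [Real.rpow_two, sq_abs]
    push_cast
    ring_nf
  · simp only [abs_mul, abs_of_nonneg hc, Real.mul_rpow hc (abs_nonneg _)]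
    push_cast
    rfl

/-- In the duality with `c = n`, the stable side is always at least the mass at `0`, while the
Gaussian side tends to `0`. -/
theorem measure_singleton_zero_of_charFun_eq (hα : 0 < α)
    (hσ : ∀ t : ℝ, charFun σ t = Complex.exp (-((|t| ^ α : ℝ) : ℂ))) : σ {0} = 0 := by
  have hγ : ∀ᵐ g ∂(gaussianReal 0 1), g ≠ 0 := by
    have := nullSingletonClass_gaussianReal (μ := 0) (v := 1) one_ne_zero
    simp [ae_iff]
  have hlim : Filter.Tendsto
      (fun n : ℕ => ∫ g, Real.exp (-((n : ℝ) ^ α * |g| ^ α)) ∂(gaussianReal 0 1))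
      Filter.atTop (nhds (∫ _, (0 : ℝ) ∂(gaussianReal 0 1))) := by
    refine tendsto_integral_of_dominated_convergence (fun _ => 1) 
      (fun n => (integrable_exp_neg_mul_abs_rpow _ (by positivity) _).aestronglyMeasurable)
      (integrable_const _) (fun n => .of_forall fun g => ?_) ?_
    · rw [Real.norm_eq_abs, Real.abs_exp, Real.exp_le_one_iff]
      have : 0 ≤ (n : ℝ) ^ α * |g| ^ α := by positivity
      linarith
    · filter_upwards [hγ] with g hg
      refine Real.tendsto_exp_neg_atTop_nhds_zero.comp ?_
      exact ((tendsto_rpow_atTop hα).comp tendsto_natCast_atTop_atTop).atTop_mul_const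
        (Real.rpow_pos_of_pos (abs_pos.2 hg) _)
  have hle : ∀ n : ℕ, σ.real {0}
      ≤ ∫ g, Real.exp (-((n : ℝ) ^ α * |g| ^ α)) ∂(gaussianReal 0 1) := by
    intro n
    rw [← integral_exp_neg_sq_eq_gaussianReal hσ n.cast_nonneg,
      ← integral_indicator_one (measurableSet_singleton 0)]
    refine integral_mono ((integrable_const (1 : ℝ)).indicator (measurableSet_singleton 0)) ?_ ?_
    · exact integrable_exp_neg_mul_abs_rpow _ (by positivity) _
    · intro s
      by_cases hs : s = 0
      · simp [hs]
      · simp [hs, Real.exp_nonneg]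
  have h0 : σ.real {0} ≤ 0 := by
    simpa using ge_of_tendsto' hlim hle
  exact (measureReal_eq_zero_iff).1 (le_antisymm h0 measureReal_nonneg)

/-- This encodes `√(2E) / |S| ~ E ^ (1/α) / |G|`: the two tails at `e^u` are the two sides of the
duality with `c = e^u`. -/
theorem charFun_map_log_of_charFun_eq (hα : 0 < α)
    (hσ : ∀ t : ℝ, charFun σ t = Complex.exp (-((|t| ^ α : ℝ) : ℂ))) (t : ℝ) :
    charFun ((expMeasure 1).map Real.log) (2⁻¹ * t) * charFun (σ.map Real.log) (-t)
        * Complex.exp (Real.log 2 * (2⁻¹ * t : ℝ) * Complex.I)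
      = charFun ((expMeasure 1).map Real.log) (α⁻¹ * t)
        * charFun ((gaussianReal 0 1).map Real.log) (-t) := by
  have hγ0 : gaussianReal 0 1 {0} = 0 := by
    have := nullSingletonClass_gaussianReal (μ := 0) (v := 1) one_ne_zero
    simp
  have hσ0 := measure_singleton_zero_of_charFun_eq hα hσ
  have iτ : IsProbabilityMeasure ((expMeasure 1).map Real.log) :=
    Measure.isProbabilityMeasure_map (by fun_prop)
  have iσ : IsProbabilityMeasure (σ.map (fun x => -2 * Real.log x)) :=
    Measure.isProbabilityMeasure_map (by fun_prop)
  have iγ : IsProbabilityMeasure ((gaussianReal 0 1).map (fun x => -α * Real.log x)) :=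
    Measure.isProbabilityMeasure_map (by fun_prop)
  have i1 : IsProbabilityMeasure (((expMeasure 1).map Real.log ∗
      σ.map (fun x => -2 * Real.log x)).map (· + Real.log 2)) :=
    Measure.isProbabilityMeasure_map (by fun_prop)
  have i2 : IsProbabilityMeasure ((((expMeasure 1).map Real.log ∗
      σ.map (fun x => -2 * Real.log x)).map (· + Real.log 2)).map (2⁻¹ * ·)) :=
    Measure.isProbabilityMeasure_map (by fun_prop)
  have i3 : IsProbabilityMeasure (((expMeasure 1).map Real.log ∗
      (gaussianReal 0 1).map (fun x => -α * Real.log x)).map (α⁻¹ * ·)) :=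
    Measure.isProbabilityMeasure_map (by fun_prop)
  have key : (((expMeasure 1).map Real.log ∗
      σ.map (fun x => -2 * Real.log x)).map (· + Real.log 2)).map (2⁻¹ * ·)
      = ((expMeasure 1).map Real.log ∗
      (gaussianReal 0 1).map (fun x => -α * Real.log x)).map (α⁻¹ * ·) := by
    refine Measure.ext_of_Iic _ _ fun u => ?_
    rw [← compl_compl (Set.Iic u), Set.compl_Iic,
      prob_compl_eq_one_sub measurableSet_Ioi, prob_compl_eq_one_sub measurableSet_Ioi]
    congr 1
    rw [Measure.map_apply (by fun_prop) measurableSet_Ioi,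
      Measure.map_apply (by fun_prop) (measurableSet_Ioi.preimage (by fun_prop)),
      Measure.map_apply (by fun_prop) measurableSet_Ioi]
    have e1 : (· + Real.log 2) ⁻¹' ((2⁻¹ * ·) ⁻¹' Set.Ioi u) = Set.Ioi (2 * u - Real.log 2) := by
      ext x
      simp only [Set.mem_preimage, Set.mem_Ioi]
      constructor <;> intro h <;> linarith
    have e2 : (α⁻¹ * ·) ⁻¹' Set.Ioi u = Set.Ioi (α * u) := by
      ext x
      simp only [Set.mem_preimage, Set.mem_Ioi]
      rw [lt_inv_mul_iff₀ hα]
    rw [e1, e2, map_log_expMeasure_one_conv_Ioi _ hσ0, map_log_expMeasure_one_conv_Ioi _ hγ0,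
      ← ofReal_integral_eq_lintegral_ofReal, ← ofReal_integral_eq_lintegral_ofReal]
    · have := integral_exp_neg_sq_eq_gaussianReal hσ (Real.exp_pos u).le
      rw [← Real.exp_nat_mul, ← Real.exp_mul] at this
      rw [Real.exp_sub, Real.exp_log two_pos, mul_comm α u, ← this]
      simp
    · exact integrable_exp_neg_mul_abs_rpow _ (by positivity) _
    · exact .of_forall fun _ => Real.exp_nonneg _
    · exact integrable_exp_neg_mul_abs_rpow _ (by positivity) _
    · exact .of_forall fun _ => Real.exp_nonneg _
  have h := congrArg (fun m => charFun m t) key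
  rw [charFun_map_mul, charFun_map_add_const, charFun_conv, charFun_map_mul_comp (by fun_prop),
    charFun_map_mul, charFun_conv, charFun_map_mul_comp (by fun_prop)] at h
  rw [show -2 * (2⁻¹ * t) = -t by ring, show -α * (α⁻¹ * t) = -t by field_simp] at h
  rw [← h]
  congr 3
  simp [mul_comm]

theorem map_log_conv_map_neg_log_of_charFun_eq (hα : 0 < α)
    (hσ : ∀ t : ℝ, charFun σ t = Complex.exp (-((|t| ^ α : ℝ) : ℂ))) :
    σ.map Real.log ∗ σ.map (fun x => -1 * Real.log x)
      = logisticLaw α ∗ (logCosLaw ∗ logCosLaw.map (-1 * ·)) := by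
  have i1 : IsProbabilityMeasure (σ.map Real.log) := Measure.isProbabilityMeasure_map (by fun_prop)
  have i2 : IsProbabilityMeasure (σ.map (fun x => -1 * Real.log x)) :=
    Measure.isProbabilityMeasure_map (by fun_prop)
  have i3 : IsProbabilityMeasure (logCosLaw.map (-1 * ·)) :=
    Measure.isProbabilityMeasure_map (by fun_prop)
  refine Measure.ext_of_charFun (funext fun t => ?_)
  rw [charFun_conv, charFun_conv, charFun_conv, charFun_map_mul_comp (by fun_prop),
    charFun_map_mul, charFun_logisticLaw, neg_one_mul]
  have h1 := charFun_map_log_of_charFun_eq hα hσ t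
  have h2 := charFun_map_log_of_charFun_eq hα hσ (-t)
  rw [charFun_map_log_gaussianReal] at h1 h2
  rw [neg_neg, mul_neg, mul_neg] at h2
  have n1 := charFun_map_log_expMeasure_one_ne_zero (2⁻¹ * t)
  have n2 := charFun_map_log_expMeasure_one_ne_zero (-(2⁻¹ * t))
  rw [show -t / 2 = -(2⁻¹ * t) by ring] at h1
  rw [show t / 2 = 2⁻¹ * t by ring] at h2
  have n3 : Complex.exp (Real.log 2 * (2⁻¹ * t : ℝ) * Complex.I) ≠ 0 := Complex.exp_ne_zero _
  have e1 : Complex.exp ((-t : ℝ) / 2 * Real.log 2 * Complex.I)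
      = Complex.exp (Real.log 2 * (-(2⁻¹ * t) : ℝ) * Complex.I) := by
    push_cast; ring_nf
  have e2 : Complex.exp ((t : ℝ) / 2 * Real.log 2 * Complex.I)
      = Complex.exp (Real.log 2 * (2⁻¹ * t : ℝ) * Complex.I) := by
    push_cast; ring_nf
  have n4 : Complex.exp (Real.log 2 * (-(2⁻¹ * t) : ℝ) * Complex.I) ≠ 0 := Complex.exp_ne_zero _
  rw [e1] at h1
  rw [e2] at h2
  have h := congrArg₂ (· * ·) h1 h2
  -- Multiplying the identities at `t` and `-t` leaves the same radial factors on both sides.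
  refine mul_left_cancel₀ (mul_ne_zero (mul_ne_zero n1 n2) (mul_ne_zero n3 n4)) ?_
  linear_combination h

theorem prod_setOf_mul_abs_lt_abs_le (hα : 0 < α)
    (hσ : ∀ t : ℝ, charFun σ t = Complex.exp (-((|t| ^ α : ℝ) : ℂ))) {c : ℝ} (hc : 0 < c)
    (hc₁ : c ≤ 1) :
    (σ.prod σ) {p | c * |p.1| < |p.2|} ≤ ENNReal.ofReal (1 / (1 + c ^ α)) := by
  have i3 : IsProbabilityMeasure (logCosLaw.map (-1 * ·)) :=
    Measure.isProbabilityMeasure_map (by fun_prop)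
  have hσ0 : ∀ᵐ x ∂σ, x ≠ 0 := by
    simpa [ae_iff] using measure_singleton_zero_of_charFun_eq hα hσ
  have i1 : IsProbabilityMeasure (σ.map Real.log) := Measure.isProbabilityMeasure_map (by fun_prop)
  have h : (σ.prod σ) {p | c * |p.1| < |p.2|}
      = (σ.map Real.log ∗ σ.map (fun x => -1 * Real.log x)) (Set.Ioi (Real.log c)) := by
    rw [Measure.conv, Measure.map_prod_map _ _ (by fun_prop) (by fun_prop),
      Measure.map_map (by fun_prop) (by fun_prop),
      Measure.map_apply (by fun_prop) measurableSet_Ioi]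
    conv_lhs => rw [← Measure.prod_swap,
      Measure.map_apply measurable_swap (measurableSet_lt (by fun_prop) (by fun_prop))]
    refine measure_congr ?_
    filter_upwards [(Measure.quasiMeasurePreserving_fst (μ := σ) (ν := σ)).ae hσ0,
      (Measure.quasiMeasurePreserving_snd (μ := σ) (ν := σ)).ae hσ0] with p h1 h2
    refine propext ?_
    change c * |p.2| < |p.1| ↔ Real.log c < Real.log p.1 + -1 * Real.log p.2
    rw [← Real.log_abs p.1, ← Real.log_abs p.2,
      ← Real.log_lt_log_iff (by positivity) (by positivity),
      Real.log_mul hc.ne' (by positivity)]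
    constructor <;> intro h <;> linarith
  have hsymm : (logCosLaw ∗ logCosLaw.map (-1 * ·)).map Neg.neg
      = logCosLaw ∗ logCosLaw.map (-1 * ·) := by
    have : IsProbabilityMeasure ((logCosLaw ∗ logCosLaw.map (-1 * ·)).map Neg.neg) :=
      Measure.isProbabilityMeasure_map (by fun_prop)
    refine Measure.ext_of_charFun (funext fun t => ?_)
    rw [show (Neg.neg : ℝ → ℝ) = (-1 * ·) by ext; simp, charFun_map_mul, charFun_conv,
      charFun_conv, charFun_map_mul, charFun_map_mul]
    simp only [neg_one_mul, neg_neg]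
    ring
  rw [h, map_log_conv_map_neg_log_of_charFun_eq hα hσ]
  refine (logisticLaw_conv_Ioi_le hα _ hsymm (Real.log_nonpos hc.le hc₁)).trans_eq ?_
  rw [Real.rpow_def_of_pos hc, mul_comm]

end Stable

/-! ### From one ratio to the whole design. -/

/-- If the variables `X i j` are jointly independent, then so are the families `(X i j)_j`. -/
theorem iIndepFun_curry {Ω ι κ : Type*} [MeasurableSpace Ω] [Fintype ι] [Fintype κ]
    {P : Measure Ω} [IsProbabilityMeasure P] {X : ι → κ → Ω → ℝ}
    (mX : ∀ i j, AEMeasurable (X i j) P) (h : iIndepFun (fun p : ι × κ => X p.1 p.2) P) :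
    iIndepFun (fun i ω => fun j => X i j ω) P := by
  have : ∀ i j, IsProbabilityMeasure (P.map (X i j)) :=
    fun i j => Measure.isProbabilityMeasure_map (mX i j)
  have hi : ∀ i, iIndepFun (X i) P := fun i => 
    h.precomp (g := fun j => (i, j)) (Prod.mk_right_injective i)
  rw [iIndepFun_iff_map_fun_eq_pi_map fun i => aemeasurable_pi_lambda _ (mX i)]
  simp_rw [(hi _).map_fun_eq_pi_map (mX _)]
  have h1 := h.map_fun_eq_pi_map fun p : ι × κ => mX p.1 p.2
  have h2 := congrArg (fun m => m.map (MeasurableEquiv.curry ι κ ℝ)) h1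
  rw [AEMeasurable.map_map_of_aemeasurable (by fun_prop)
    (aemeasurable_pi_lambda _ fun p : ι × κ => mX p.1 p.2), ← Measure.infinitePi_eq_pi,
    Measure.infinitePi_map_curry (fun i j => P.map (X i j))] at h2
  simp_rw [Measure.infinitePi_eq_pi] at h2
  exact h2

section Stable

theorem signalScale_pos {N : ℕ} (α : ℝ) {x : Fin N → ℝ} (hx : x ≠ 0) : 0 < signalScale α x := by
  obtain ⟨k, hk⟩ := Function.ne_iff.1 hx
  refine Real.rpow_pos_of_pos
    (Finset.sum_pos' (fun k _ => by positivity) ⟨k, Finset.mem_univ _, ?_⟩) _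
  exact Real.rpow_pos_of_pos (abs_pos.2 hk) _

variable {Ω : Type*} [MeasurableSpace Ω] {μ : Measure Ω} {α : ℝ}

variable [IsProbabilityMeasure μ] in
theorem IsStandardStable.measure_mul_abs_lt_abs_le {X Y : Ω → ℝ} (hα : 0 < α)
    (hX : IsStandardStable α X μ) (hY : IsStandardStable α Y μ) (hXY : IndepFun X Y μ)
    {c : ℝ} (hc : 0 < c) (hc₁ : c ≤ 1) :
    μ {ω | c * |X ω| < |Y ω|} ≤ ENNReal.ofReal (1 / (1 + c ^ α)) := by
  have iX : IsProbabilityMeasure (μ.map X) := Measure.isProbabilityMeasure_map hX.aemeasurable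
  have iY : IsProbabilityMeasure (μ.map Y) := Measure.isProbabilityMeasure_map hY.aemeasurable
  have hlaw : μ.map Y = μ.map X :=
    Measure.ext_of_charFun (funext fun t => by rw [hX.charFun_eq, hY.charFun_eq])
  have hprod := (indepFun_iff_map_prod_eq_prod_map_map hX.aemeasurable hY.aemeasurable).1 hXY
  rw [hlaw] at hprod
  refine le_trans (le_of_eq ?_) (prod_setOf_mul_abs_lt_abs_le hα hX.charFun_eq hc hc₁)
  rw [← hprod, Measure.map_apply_of_aemeasurable (hX.aemeasurable.prodMk hY.aemeasurable)
    (measurableSet_lt (by fun_prop) (by fun_prop))]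
  rfl

/-- A linear combination of independent standard stable variables, divided by its scale, is
standard stable. -/
theorem isStandardStable_inv_signalScale_mul_sum {N : ℕ} (hα : 0 < α) {X : Fin N → Ω → ℝ}
    (hX : ∀ k, IsStandardStable α (X k) μ) (hind : iIndepFun X μ) {x : Fin N → ℝ} (hx : x ≠ 0) :
    IsStandardStable α (fun ω => (signalScale α x)⁻¹ * ∑ k, x k * X k ω) μ := by
  have hm : ∀ k, AEMeasurable (fun ω => x k * X k ω) μ := fun k => (hX k).aemeasurable.const_mul _
  have hs : AEMeasurable (fun ω => ∑ k, x k * X k ω) μ :=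
    Finset.aemeasurable_fun_sum _ fun k _ => hm k
  have hind' : iIndepFun (fun k ω => x k * X k ω) μ :=
    hind.comp (fun k y => x k * y) fun k => by fun_prop
  refine ⟨hs.const_mul _, fun t => ?_⟩
  rw [charFun_map_mul_comp hs, hind'.charFun_map_fun_sum_eq_prod hm, Finset.prod_apply]
  simp_rw [charFun_map_mul_comp (hX _).aemeasurable, (hX _).charFun_eq]
  rw [← Complex.exp_sum]
  congr 1
  have hθ := signalScale_pos α hx
  have h0 : ∑ k, |x k| ^ α = signalScale α x ^ α := by
    rw [signalScale, ← Real.rpow_mul (Finset.sum_nonneg fun k _ => by positivity),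
      one_div_mul_cancel hα.ne', Real.rpow_one]
  rw [Finset.sum_neg_distrib, ← Complex.ofReal_sum]
  congr 2
  simp_rw [abs_mul, Real.mul_rpow (abs_nonneg (x _))
    (by positivity : 0 ≤ |(signalScale α x)⁻¹| * |t|)]
  rw [← Finset.sum_mul, h0, abs_of_pos (inv_pos.2 hθ), Real.mul_rpow (by positivity) (by positivity),
    Real.inv_rpow hθ.le, mul_inv_cancel_left₀ (by positivity)]

variable [IsProbabilityMeasure μ] in
theorem IsStableDesign.measure_mul_abs_lt_abs_vecMul_le {N M : ℕ} (hα : 0 < α)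
    {S : Ω → Matrix (Fin N) (Fin M) ℝ} (hS : IsStableDesign α S μ) {x : Fin N → ℝ} (hx : x ≠ 0)
    {i : Fin N} (hi : x i = 0) {c : ℝ} (hc : 0 < c) (hc₁ : c ≤ 1) (j : Fin M) :
    μ {ω | c * signalScale α x * |S ω i j| < |(x ᵥ* S ω) j|}
      ≤ ENNReal.ofReal (1 / (1 + c ^ α)) := by
  have hind : iIndepFun (fun k ω => S ω k j) μ :=
    hS.indep.precomp (g := fun k : Fin N => (k, j)) (Prod.mk_left_injective j)
  have hY := isStandardStable_inv_signalScale_mul_sum hα (fun k => hS.stable k j) hind hx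
  have hθ := signalScale_pos α hx
  have hXY : IndepFun (fun ω => S ω i j)
      (fun ω => (signalScale α x)⁻¹ * ∑ k, x k * S ω k j) μ := by
    -- Entry `i` stays unscaled, hence independent of the weighted sum over the others, which is all
    -- of `y_j` since `x i = 0`.
    let φ : Fin N → ℝ → ℝ := fun k y => if k = i then y else x k * y
    have hφ : ∀ k, Measurable (φ k) := fun k => by
      by_cases hk : k = i <;> simp only [φ, hk, if_true, if_false] <;> fun_prop
    have h1 := (hind.comp φ hφ).indepFun_finsetSum_of_notMem₀
      (fun k => (hφ k).comp_aemeasurable (hS.stable k j).aemeasurable)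
      (Finset.notMem_erase i Finset.univ)
    have h2 := h1.symm.comp measurable_id (measurable_const_mul (signalScale α x)⁻¹)
    convert h2 using 1
    · ext ω; simp [φ]
    · ext ω
      simp only [Function.comp_apply, Finset.sum_apply]
      rw [← Finset.add_sum_erase _ _ (Finset.mem_univ i), hi, zero_mul, zero_add]
      congr 1
      refine Finset.sum_congr rfl fun k hk => ?_
      simp [φ, Finset.ne_of_mem_erase hk]
  refine le_trans (le_of_eq ?_) ((hS.stable i j).measure_mul_abs_lt_abs_le hα hY hXY hc hc₁)
  congr 1 with ω
  simp only [Set.mem_ofPred_eq, Matrix.vecMul, dotProduct]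
  rw [abs_mul, abs_of_pos (inv_pos.2 hθ), lt_inv_mul_iff₀ hθ]
  ring_nf

variable [IsProbabilityMeasure μ] in
theorem IsStableDesign.measure_forall_mul_abs_lt_abs_vecMul_le {N M : ℕ} (hα : 0 < α)
    {S : Ω → Matrix (Fin N) (Fin M) ℝ} (hS : IsStableDesign α S μ) {x : Fin N → ℝ} (hx : x ≠ 0)
    {i : Fin N} (hi : x i = 0) {c : ℝ} (hc : 0 < c) (hc₁ : c ≤ 1) :
    μ {ω | ∀ j, c * signalScale α x * |S ω i j| < |(x ᵥ* S ω) j|}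
      ≤ ENNReal.ofReal (1 / (1 + c ^ α)) ^ M := by
  have hcol : iIndepFun (fun j ω => fun k => S ω k j) μ := by
    refine iIndepFun_curry (X := fun j k ω => S ω k j)
      (fun j k => (hS.stable k j).aemeasurable) ?_
    exact hS.indep.precomp Prod.swap_injective
  let B : Set (Fin N → ℝ) := {w | c * signalScale α x * |w i| < |∑ k, x k * w k|}
  have hB : MeasurableSet B := measurableSet_lt (by fun_prop) (by fun_prop)
  have h := hcol.meas_iInter (s := fun j => (fun ω k => S ω k j) ⁻¹' B)
    fun j => ⟨B, hB, rfl⟩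
  have e : {ω | ∀ j, c * signalScale α x * |S ω i j| < |(x ᵥ* S ω) j|}
      = ⋂ j, (fun ω k => S ω k j) ⁻¹' B := by
    ext ω
    simp [B, Matrix.vecMul, dotProduct]
  rw [e, h]
  calc _ ≤ ∏ _j : Fin M, ENNReal.ofReal (1 / (1 + c ^ α)) :=
        Finset.prod_le_prod' fun j _ => hS.measure_mul_abs_lt_abs_vecMul_le hα hx hi hc hc₁ j
    _ = _ := by simp

theorem lt_mul_of_lt_abs_absMinEstimator {N M : ℕ} [NeZero M] {A : Matrix (Fin N) (Fin M) ℝ}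
    {y : Fin M → ℝ} {i : Fin N} {ε : ℝ} (hε : 0 < ε) (h : ε < |absMinEstimator A y i|)
    (j : Fin M) : ε * |A i j| < |y j| := by
  have h1 : ε < |y j / A i j| := h.trans_le (abs_argminAbs_le (ratioStat A y i) j)
  -- Division by zero yields a ratio of `0`, which cannot exceed `ε`.
  rcases eq_or_ne (A i j) 0 with h0 | h0
  · simp only [h0, div_zero, abs_zero] at h1
    exact absurd h1 hε.not_gt
  · rwa [abs_div, lt_div_iff₀ (abs_pos.2 h0)] at h1

/-- The bound `c ^ α` on the odds produced by `IsStableDesign.measure_mul_abs_lt_abs_vecMul_le` is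
at least `ψ`, for a suitable threshold `c ≤ 1`. -/
theorem exists_threshold {r : ℝ} (hα₀ : 0 < α) (hα₁ : α ≠ 1) (hr : 0 < r)
    (hψ : r ^ (α / (1 - α)) ≤ 1) :
    ∃ c, 0 < c ∧ c ≤ 1 ∧ c ≤ r ∧ r ^ (α / (1 - α)) ≤ c ^ α := by
  rcases lt_or_gt_of_ne hα₁ with h | h
  · have h1 : 0 < 1 - α := sub_pos.2 h
    have hr1 : r ≤ 1 := by
      by_contra! hcon
      exact absurd hψ (Real.one_lt_rpow hcon (by positivity)).not_ge
    -- For `α < 1` the exponents satisfy `α ≤ α / (1 - α)`, and `r ≤ 1`.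
    refine ⟨r, hr, hr1, le_rfl, Real.rpow_le_rpow_of_exponent_ge hr hr1 ?_⟩
    rw [le_div_iff₀ h1]
    nlinarith
  · have h1 : 1 - α < 0 := sub_neg.2 h
    have hr1 : 1 ≤ r := by
      by_contra! hcon
      exact absurd hψ (Real.one_lt_rpow_of_pos_of_lt_one_of_neg hr hcon
        (div_neg_of_pos_of_neg hα₀ h1)).not_ge
    -- For `α > 1`, `r ≥ 1` may lie outside the range of the ratio bound, so the threshold is
    -- lowered to `1`.
    exact ⟨1, one_pos, le_rfl, hr1, by rwa [Real.one_rpow]⟩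

end Stable

theorem mainTheorem2 {Ω : Type*} [MeasurableSpace Ω] (μ : Measure Ω) [IsProbabilityMeasure μ]
    {N M : ℕ} [NeZero M] (α : ℝ) (hα₀ : 0 < α) (hα₂ : α ≤ 2) (hα₁ : α ≠ 1)
    (S : Ω → Matrix (Fin N) (Fin M) ℝ) (hS : IsStableDesign α S μ)
    (x : Fin N → ℝ) (hx : x ≠ 0) (ε : ℝ) (hε : 0 < ε) (hψ : psi α ε x ≤ 1 / 3) (i : Fin N) :
    μ.real {ω | ε < |absMinEstimator (S ω) (x ᵥ* S ω) i| ∧ x i = 0}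
      ≤ 1 / (1 + psi α ε x) ^ M := by
  have hθ := signalScale_pos α hx
  have hψ0 : 0 ≤ psi α ε x := by unfold psi; positivity
  by_cases hi : x i = 0
  swap
  · simp only [hi, and_false, Set.ofPred_false, measureReal_empty]
    positivity
  obtain ⟨c, hc, hc₁, hcr, hcψ⟩ : ∃ c, 0 < c ∧ c ≤ 1 ∧ c ≤ ε / signalScale α x ∧
      psi α ε x ≤ c ^ α :=
    exists_threshold hα₀ hα₁ (div_pos hε hθ) (hψ.trans (by norm_num))
  rw [le_div_iff₀ hθ] at hcr
  have hsub : {ω | ε < |absMinEstimator (S ω) (x ᵥ* S ω) i| ∧ x i = 0}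
      ⊆ {ω | ∀ j, c * signalScale α x * |S ω i j| < |(x ᵥ* S ω) j|} := fun ω hω j =>
    (mul_le_mul_of_nonneg_right hcr (abs_nonneg _)).trans_lt
      (lt_mul_of_lt_abs_absMinEstimator hε hω.1 j)
  have h := (measure_mono hsub).trans
    (hS.measure_forall_mul_abs_lt_abs_vecMul_le hα₀ hx hi hc hc₁)
  rw [← ENNReal.ofReal_pow (by positivity)] at h
  calc _ ≤ (1 / (1 + c ^ α)) ^ M := ENNReal.toReal_le_of_le_ofReal (by positivity) h
    _ ≤ (1 / (1 + psi α ε x)) ^ M := by gcongr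
    _ = _ := by rw [one_div_pow]
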